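/- Let $\ell$ be a prime, and let $a \ge 1$ and $r \ge 0$ be integers. Let $W_r(\ell) = C_\ell \wr \cdots \wr C_\ell$ be the $r$-fold iterated permutational wreath product of cyclic groups of order $\ell$, regarded as a permutation group of degree $\ell^r$ (so $W_0(\ell)$ is trivial, of degree $1$), and let $X_{a,r}(\ell) := C_{\ell^a} \wr W_r(\ell)$ be the permutational wreath product of the cyclic group of order $\ell^a$ with $W_r(\ell)$, with respect to this action on $\ell^r$ points. For a finite group $G$ put $\operatorname{rk}(G) := \sup\{ d(H) \mid H \le G\}$, where $H$ ranges over all subgroups of $G$ and $d(H)$ is the minimal number of generators of $H$. Then $$ \operatorname{rk}(X_{a,r}(\ell)) = \begin{cases} 3 \cdot 2^{r-1} & \text{if } \ell = 2,\ a \ge 2 \text{ and } r \ge 1,\\ \ell^r & \text{in all other cases.} \end{cases} $$ -/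

import Mathlib

/-- The rank of a finite group `G`: the supremum of `d(H)` over all subgroups `H` of `G`, where
`d(H) = Group.rank H` is the minimal number of generators of `H`. -/
noncomputable def subgroupRank (G : Type*) [Group G] [Finite G] : ℕ∞ :=
  ⨆ H : Subgroup G, (Group.rank H : ℕ∞)

/-- The permutational wreath product `A ≀ Q` for a group `Q` acting on `Ω` through `π`:
the semidirect product of the base group `Ω → A` and `Q`, where `q : Q` acts on the base group
by `(q • f) ω = f (π q⁻¹ ω)`. -/
abbrev PermWreathProduct (A : Type*) {Q Ω : Type*} [Group A] [Group Q]
    (π : Q →* Equiv.Perm Ω) : Type _ :=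
  (Ω → A) ⋊[(mulAutArrow (G := Equiv.Perm Ω) (A := Ω) (M := A)).comp π] Q

instance PermWreathProduct.instFinite (A : Type*) {Q Ω : Type*} [Group A] [Group Q]
    [Finite A] [Finite Q] [Finite Ω] (π : Q →* Equiv.Perm Ω) :
    Finite (PermWreathProduct A π) :=
  Finite.of_equiv _ SemidirectProduct.equivProd.symm

/-- The cyclic group of order `n`, written multiplicatively. -/
abbrev CyclicGrp (n : ℕ) : Type := Multiplicative (ZMod n)

/-- `W_r(ℓ) = C_ℓ ≀ ⋯ ≀ C_ℓ` (`r` factors), with its natural permutation representation on the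
`ℓ ^ r` points `Fin r → C_ℓ` given by `iteratedWreathToPermHom`. -/
abbrev WGroup (r ℓ : ℕ) : Type := IteratedWreathProduct (CyclicGrp ℓ) r

/-- `X_{a,r}(ℓ) = C_{ℓ^a} ≀ W_r(ℓ)`, formed with respect to the natural action of `W_r(ℓ)` on
`ℓ ^ r` points. -/
abbrev XGroup (a r ℓ : ℕ) : Type :=
  PermWreathProduct (CyclicGrp (ℓ ^ a)) (iteratedWreathToPermHom (CyclicGrp ℓ) r)

/-! Upper bound. A subgroup of X is an ℓ-group of monomial permutations of n = ℓ^r points with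
entries in a cyclic group A. Bounds linear in n add up over orbits (`monomialBound_of_transitive`),
so let G be transitive and n > 1. The permutation image has a central element of order ℓ. By
transitivity it has no fixed point, so n = ℓm with m the number of its orbits. A lift of it to G
makes the kernel K ≤ A^n of the permutation action a C_ℓ-module whose fixed ℓ-torsion has at most
ℓ^m elements. A Nakayama argument then generates K by 2m elements, or by m if K has exponent ℓ
(`exists_finset_generating_of_pow_eq_one`). The permutation image needs at most n/ℓ = m generators
(`mul_rank_le_card`, by the same method on the orbits of a central element). So d(G) ≤ 3m, or 2m if
A has exponent ℓ; this is at most n = ℓm unless ℓ = 2 and a ≥ 2, when it is 3n/2.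

Lower bound. The base group maps onto (ℤ/ℓ)^n. If ℓ = 2 and a ≥ 2, then C_{2^a} ≀ C_2 contains the
central product of C_4 and D_4, whose Frattini quotient has rank 3; for r ≥ 1, X contains a direct
product of 2^{r-1} such groups (`frattiniRelation`). -/

namespace WreathRank

/-! ### Generators of a group extension -/

section Rank

variable {G G' : Type*} [Group G] [Group G'] [Finite G]

/-- If `T` generates `G` together with any lift of a generating set of the image of `f`, then
`d(G)` is at most `d(f(G)) + |T|`. -/
lemma rank_le_rank_range_add_card (f : G →* G') (T : Finset G)
    (hT : ∀ L : Subgroup G, (T : Set G) ⊆ L → L.map f = f.range → L = ⊤) :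
    Group.rank G ≤ Group.rank f.range + T.card := by
  classical
  obtain ⟨S, hS, hS'⟩ := Group.rank_spec f.range
  choose g hg using f.rangeRestrict_surjective
  have key : Subgroup.closure ((S.image g ∪ T : Finset G) : Set G) = ⊤ := by
    apply hT
    · intro x hx
      exact Subgroup.subset_closure (by simp [Finset.mem_coe.1 hx])
    · refine le_antisymm (Subgroup.map_le_range _ _) ?_
      rintro _ ⟨x, rfl⟩
      have hle : Subgroup.closure (S : Set f.range) ≤
          (Subgroup.closure ((S.image g ∪ T : Finset G) : Set G)).map f.rangeRestrict := by
        rw [Subgroup.closure_le]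
        intro s hs
        refine ⟨g s, Subgroup.subset_closure ?_, hg s⟩
        simp only [Finset.coe_union, Finset.coe_image]
        exact Or.inl ⟨s, hs, rfl⟩
      obtain ⟨y, hy, hyx⟩ := hle (hS' ▸ Subgroup.mem_top (f.rangeRestrict x))
      exact ⟨y, hy, congrArg Subtype.val hyx⟩
  calc Group.rank G ≤ (S.image g ∪ T).card := Group.rank_le key
    _ ≤ (S.image g).card + T.card := Finset.card_union_le _ _
    _ ≤ Group.rank f.range + T.card := by
      rw [← hS]; exact Nat.add_le_add_right Finset.card_image_le _

omit [Finite G] in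
lemma eq_top_of_map_eq_range (f : G →* G') {L : Subgroup G} (hL : L.map f = f.range)
    (hK : f.ker ≤ L) : L = ⊤ := by
  have := Subgroup.comap_map_eq_self hK
  rw [← this, hL]
  ext x
  simp

lemma rank_le_rank_range_add_rank_ker (f : G →* G') :
    Group.rank G ≤ Group.rank f.range + Group.rank f.ker := by
  classical
  obtain ⟨S, hS, hS'⟩ := Group.rank_spec f.ker
  refine (rank_le_rank_range_add_card f (S.image Subtype.val) fun L hTL hL ↦
    eq_top_of_map_eq_range f hL ?_).trans
      (Nat.add_le_add_left (Finset.card_image_le.trans hS.le) _)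
  have : (⊤ : Subgroup f.ker) ≤ L.comap f.ker.subtype := by
    rw [← hS', Subgroup.closure_le]
    intro s hs
    exact hTL (by simpa using hs)
  intro x hx
  exact this (Subgroup.mem_top ⟨x, hx⟩)

/-- If the kernel of `f` is commutative and is generated by `T` under conjugation by `z`, then
`d(G)` is at most `d(f(G)) + |T|`. -/
lemma rank_le_of_conj_generate_ker (f : G →* G') (hK : ∀ x ∈ f.ker, ∀ y ∈ f.ker, x * y = y * x)
    (z : G) (T : Finset G) (hTK : (T : Set G) ⊆ f.ker)
    (hT : ∀ L ≤ f.ker, (T : Set G) ⊆ L → (∀ x ∈ L, z * x * z⁻¹ ∈ L) → f.ker ≤ L) :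
    Group.rank G ≤ Group.rank f.range + T.card := by
  refine rank_le_rank_range_add_card f T fun L hTL hL ↦ eq_top_of_map_eq_range f hL ?_
  -- `L` may not contain `z`, but it contains some `y` in the same coset of the commutative kernel,
  -- which conjugates the kernel in the same way.
  obtain ⟨y, hyL, hyz⟩ : f z ∈ L.map f := hL ▸ ⟨z, rfl⟩
  refine (hT (L ⊓ f.ker) inf_le_right (fun x hx ↦ ⟨hTL hx, hTK hx⟩) ?_).trans inf_le_left
  rintro x ⟨hxL, hxK⟩
  refine ⟨?_, (MonoidHom.normal_ker f).conj_mem x hxK z⟩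
  have hk : y⁻¹ * z ∈ f.ker := by simp [MonoidHom.mem_ker, hyz]
  have h1 : z * x * z⁻¹ = y * ((y⁻¹ * z) * x) * z⁻¹ := by group
  have h2 : z * x * z⁻¹ = y * x * y⁻¹ := by
    rw [h1, hK _ hk _ hxK]; group
  rw [SetLike.mem_coe, h2]
  exact L.mul_mem (L.mul_mem hyL hxL) (L.inv_mem hyL)

end Rank

lemma card_subtype_le_of_imp {α : Type*} [Finite α] {p q : α → Prop} (h : ∀ x, p x → q x) :
    Nat.card {x // p x} ≤ Nat.card {x // q x} :=
  Nat.card_le_card_of_injective (Subtype.map id h) (Subtype.map_injective h Function.injective_id)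

/-! ### Generators of modules over a cyclic group of order ℓ -/

section Generation

variable {M : Type*} [AddCommGroup M] [Finite M] {ℓ : ℕ} [hℓ : Fact ℓ.Prime]

/-- Orders of subgroups are powers of ℓ, so adjoining an element outside `N₁` multiplies the order
by at least ℓ. -/
lemma exists_finset_le_closure_sup {k : ℕ} (hM : Nat.card M = ℓ ^ k) (N : AddSubgroup M) (m : ℕ)
    (N₁ : AddSubgroup M) (hN₁ : N₁ ≤ N) (hcard : Nat.card N ≤ ℓ ^ m * Nat.card N₁) :
    ∃ T : Finset M, (T : Set M) ⊆ N ∧ T.card ≤ m ∧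
      N ≤ AddSubgroup.closure (T : Set M) ⊔ N₁ := by
  classical
  induction m generalizing N₁ with
  | zero =>
    refine ⟨∅, by simp, le_rfl, le_sup_of_le_right ?_⟩
    exact (AddSubgroup.eq_of_le_of_card_ge hN₁ (by simpa using hcard)).ge
  | succ m ih =>
    by_cases hN : N ≤ N₁
    · exact ⟨∅, by simp, by simp, le_sup_of_le_right hN⟩
    obtain ⟨x, hxN, hx⟩ := SetLike.not_le_iff_exists.1 hN
    set N₂ := N₁ ⊔ AddSubgroup.zmultiples x
    have hx₂ : x ∈ N₂ := le_sup_right (a := N₁) (AddSubgroup.mem_zmultiples x)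
    have h₂ : N₂ ≤ N := sup_le hN₁ (by simpa using hxN)
    have hcard₂ : ℓ * Nat.card N₁ ≤ Nat.card N₂ := by
      have d₁ := N₁.card_addSubgroup_dvd_card
      have d₂ := N₂.card_addSubgroup_dvd_card
      rw [hM, Nat.dvd_prime_pow hℓ.out] at d₁ d₂
      obtain ⟨i, -, hi⟩ := d₁
      obtain ⟨j, -, hj⟩ := d₂
      have hlt : Nat.card N₁ < Nat.card N₂ := by
        by_contra! h
        exact hx ((AddSubgroup.eq_of_le_of_card_ge le_sup_left h).ge hx₂)
      rw [hi, hj] at hlt ⊢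
      rw [← pow_succ']
      exact Nat.pow_le_pow_right hℓ.out.pos
        ((Nat.pow_lt_pow_iff_right hℓ.out.one_lt).1 hlt)
    obtain ⟨T, hTN, hTm, hT⟩ := ih N₂ h₂ (hcard.trans (by
      rw [pow_succ, mul_assoc]; exact Nat.mul_le_mul_left _ hcard₂))
    refine ⟨insert x T, ?_, (Finset.card_insert_le _ _).trans (by omega), hT.trans ?_⟩
    · rw [Finset.coe_insert]
      exact Set.insert_subset hxN hTN
    · refine sup_le (le_sup_of_le_left (AddSubgroup.closure_mono (by simp)))
        (sup_le le_sup_right (le_sup_of_le_left ?_))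
      rw [AddSubgroup.zmultiples_le]
      exact AddSubgroup.subset_closure (by simp)

-- Turns the index of `δN` in `N`, which controls the number of generators, into the order of `N ⊓
-- ker δ`, which can be bounded.
omit [Finite M] in
lemma card_map_mul_card_inf_ker (N : AddSubgroup M) (δ : M →+ M) :
    Nat.card (N.map δ) * Nat.card (N ⊓ δ.ker : AddSubgroup M) = Nat.card N := by
  have h := (δ.comp N.subtype).ker.card_eq_card_quotient_mul_card_addSubgroup
  rw [h]
  congr 1
  · rw [Nat.card_congr (QuotientAddGroup.quotientKerEquivRange (δ.comp N.subtype)).toEquiv]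
    have : (δ.comp N.subtype).range = N.map δ := by
      rw [AddMonoidHom.range_eq_map, ← AddSubgroup.map_map, ← AddMonoidHom.range_eq_map,
        AddSubgroup.range_subtype]
    rw [this]
  · refine Nat.card_congr ⟨fun x ↦ ⟨⟨x.1, x.2.1⟩, x.2.2⟩, fun x ↦ ⟨x.1.1, x.1.2, x.2⟩, ?_, ?_⟩
    · intro x; rfl
    · intro x; rfl

/-- If `δ` is nilpotent and at most `ℓ ^ m` elements of the `δ`-invariant subgroup `N` are killed
by `δ`, then `N` is generated by `m` elements under `δ`. -/
lemma exists_finset_generating {k : ℕ} (hM : Nat.card M = ℓ ^ k) (δ : AddMonoid.End M)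
    (hδ : IsNilpotent δ) (N : AddSubgroup M) (hN : ∀ x ∈ N, δ x ∈ N) (m : ℕ)
    (hcard : Nat.card (N ⊓ AddMonoidHom.ker δ : AddSubgroup M) ≤ ℓ ^ m) :
    ∃ T : Finset M, (T : Set M) ⊆ N ∧ T.card ≤ m ∧
      ∀ L : AddSubgroup M, (T : Set M) ⊆ L → (∀ x ∈ L, δ x ∈ L) → N ≤ L := by
  obtain ⟨T, hTN, hTm, hT⟩ := exists_finset_le_closure_sup hM N m (N.map δ)
    (by rintro _ ⟨x, hx, rfl⟩; exact hN x hx) (by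
      rw [← card_map_mul_card_inf_ker N δ, mul_comm]
      exact Nat.mul_le_mul_right _ hcard)
  refine ⟨T, hTN, hTm, fun L hTL hL ↦ ?_⟩
  obtain ⟨n, hn⟩ := hδ
  -- Nakayama: `N ≤ L + δN` iterates to `N ≤ L + δ^n N`, and the last term vanishes for large `n`.
  have key : ∀ n : ℕ, ∀ x ∈ N, ∃ l ∈ L, ∃ y ∈ N, x = l + (δ ^ n) y := by
    intro n
    induction n with
    | zero => exact fun x hx ↦ ⟨0, L.zero_mem, x, hx, by simp⟩
    | succ n ih =>
      intro x hx
      obtain ⟨l, hl, y, hy, rfl⟩ := ih x hx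
      obtain ⟨u, hu, _, ⟨w, hw, rfl⟩, rfl⟩ := AddSubgroup.mem_sup.1 (hT hy)
      have hu' : u ∈ L := (AddSubgroup.closure_le L).2 hTL hu
      have hpow : ∀ n : ℕ, (δ ^ n) u ∈ L := by
        intro n
        induction n with
        | zero => simpa
        | succ n ih => rw [pow_succ']; exact hL _ ih
      refine ⟨l + (δ ^ n) u, L.add_mem hl (hpow n), w, hw, ?_⟩
      rw [map_add, pow_succ, add_assoc]
      rfl
  intro x hx
  obtain ⟨l, hl, y, -, rfl⟩ := key n x hx
  simpa [hn] using hl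

-- Modulo ℓ, `(z - 1)^ℓ` equals `z^ℓ - 1 = 0`; hence `(z - 1)^ℓ` is a multiple of ℓ and its `a`-th
-- power is zero.
omit [Finite M] in
lemma isNilpotent_sub_one {a : ℕ} (ha : ∀ x : M, ℓ ^ a • x = 0) (z : AddMonoid.End M)
    (hz : z ^ ℓ = 1) : IsNilpotent (z - 1) := by
  have hc : Commute (z - 1) 1 := Commute.one_right _
  obtain ⟨c, h⟩ := hc.exists_add_pow_prime_eq hℓ.out
  have h' : (z - 1) ^ ℓ = (ℓ : AddMonoid.End M) * -((z - 1) * c) := by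
    rw [sub_add_cancel, hz, one_pow, mul_one, mul_assoc] at h
    rw [mul_neg, eq_neg_iff_add_eq_zero]
    calc _ = (z - 1) ^ ℓ + 1 + (ℓ : AddMonoid.End M) * ((z - 1) * c) - 1 := by abel
      _ = 0 := by rw [← h, sub_self]
  refine ⟨ℓ * a, ?_⟩
  rw [pow_mul, h', (Nat.cast_commute _ _).mul_pow, ← Nat.cast_pow]
  ext x
  rw [AddMonoid.End.coe_mul, Function.comp_apply, AddMonoid.End.natCast_apply, ha]
  rfl

-- If `z y - y` is fixed, `z` translates `y` by it at each step. For `n = ℓ` this places the fixed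
-- points in the range of `z - 1` inside the ℓ-torsion.
omit [Finite M] in
lemma nsmul_eq_zero_of_pow_eq_one (z : AddMonoid.End M) {n : ℕ} (hz : z ^ n = 1) (y : M)
    (hy : z (z y - y) = z y - y) : n • (z y - y) = 0 := by
  have key : ∀ j : ℕ, (z ^ j) y = y + j • (z y - y) := by
    intro j
    induction j with
    | zero => simp
    | succ j ih =>
      rw [pow_succ', AddMonoid.End.coe_mul, Function.comp_apply, ih, map_add, map_nsmul, hy, succ_nsmul]
      abel
  have := key n
  rw [hz] at this
  simpa using this

/-- Generation of a `ℤ/ℓ^a[C_ℓ]`-module by twice the rank of the `ℓ`-torsion of its fixed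
points, and by that rank itself when the module is killed by `ℓ`. -/
lemma exists_finset_generating_of_pow_eq_one {k a : ℕ} (hM : Nat.card M = ℓ ^ k)
    (ha : ∀ x : M, ℓ ^ a • x = 0) (z : AddMonoid.End M) (hz : z ^ ℓ = 1) (m : ℕ)
    (hcard : Nat.card {x : M // z x = x ∧ ℓ • x = 0} ≤ ℓ ^ m) :
    ∃ T : Finset M, T.card ≤ 2 * m ∧ ((∀ x : M, ℓ • x = 0) → T.card ≤ m) ∧
      ∀ L : AddSubgroup M, (T : Set M) ⊆ L → (∀ x ∈ L, z x ∈ L) → L = ⊤ := by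
  classical
  by_cases h₁ : ∀ x : M, ℓ • x = 0
  · obtain ⟨T, -, hTm, hT⟩ := exists_finset_generating hM (z - 1)
      (isNilpotent_sub_one ha z hz) ⊤ (fun x hx ↦ trivial) m (by
        refine (card_subtype_le_of_imp fun x hx ↦ ?_).trans hcard
        exact ⟨sub_eq_zero.1 hx.2, h₁ x⟩)
    exact ⟨T, by omega, fun _ ↦ hTm, fun L hTL hL ↦
      top_le_iff.1 (hT L hTL fun x hx ↦ L.sub_mem (hL x hx) hx)⟩
  -- `M` is an extension of `range δ` by `ker δ`. The first is generated under `δ`, the second under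
  -- multiplication by ℓ; in both the relevant kernel lies in the fixed ℓ-torsion, so each costs `m`
  -- generators.
  set δ := z - 1
  obtain ⟨T₁, hT₁N, hT₁m, hT₁⟩ := exists_finset_generating hM (ℓ : AddMonoid.End M)
    ⟨a, by ext x; rw [← Nat.cast_pow, AddMonoid.End.natCast_apply, ha]; rfl⟩
    (AddMonoidHom.ker δ) (fun x hx ↦ by
      rw [AddMonoid.End.natCast_apply]; exact AddSubgroup.nsmul_mem _ hx _) m (by
      refine (card_subtype_le_of_imp fun x hx ↦ ?_).trans hcard
      exact ⟨sub_eq_zero.1 hx.1, hx.2⟩)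
  obtain ⟨T₂, hT₂N, hT₂m, hT₂⟩ := exists_finset_generating hM δ (isNilpotent_sub_one ha z hz)
    (AddMonoidHom.range δ) (fun x hx ↦ ⟨x, rfl⟩) m (by
      refine (card_subtype_le_of_imp ?_).trans hcard
      rintro _ ⟨⟨y, rfl⟩, hx⟩
      exact ⟨sub_eq_zero.1 hx, nsmul_eq_zero_of_pow_eq_one z hz y (sub_eq_zero.1 hx)⟩)
  choose! g hg using fun t (ht : t ∈ T₂) ↦ hT₂N ht
  refine ⟨T₁ ∪ T₂.image g, (Finset.card_union_le _ _).trans ?_, fun h ↦ absurd h h₁, fun L hTL hL ↦ ?_⟩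
  · have := Finset.card_image_le (s := T₂) (f := g)
    omega
  · rw [Finset.coe_union, Set.union_subset_iff] at hTL
    have hLδ : ∀ x ∈ L, δ x ∈ L := fun x hx ↦ L.sub_mem (hL x hx) hx
    have h₁ := hT₁ L hTL.1 (fun x hx ↦ by
      rw [AddMonoid.End.natCast_apply]; exact L.nsmul_mem hx _)
    have h₂ := hT₂ (L.map δ) (fun t ht ↦ ⟨g t, hTL.2 (by simpa using ⟨t, Finset.mem_coe.1 ht, rfl⟩), hg t ht⟩)
      (by rintro _ ⟨x, hx, rfl⟩; exact ⟨δ x, hLδ x hx, rfl⟩)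
    refine (AddSubgroup.eq_top_iff' L).2 fun x ↦ ?_
    obtain ⟨y, hy, hyx⟩ := h₂ ⟨x, rfl⟩
    have : x - y ∈ AddMonoidHom.ker δ := by
      refine (AddMonoidHom.mem_ker).2 ?_
      exact (map_sub δ x y).trans (sub_eq_zero.2 hyx.symm)
    simpa using L.add_mem (h₁ this) hy

end Generation

/-! ### Commutative kernels as modules -/

section KernelBound

variable {G G' : Type*} [Group G] [Group G'] [Finite G] {ℓ : ℕ} [hℓ : Fact ℓ.Prime]

/-- Since `z ^ ℓ` lies in the commutative kernel, conjugation by `z` on it has order dividing ℓ, and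
the module bounds apply. -/
lemma rank_le_of_card_centralized_torsion (hG : IsPGroup ℓ G) (f : G →* G')
    (hK : ∀ x ∈ f.ker, ∀ y ∈ f.ker, x * y = y * x) {a : ℕ} (ha : ∀ x ∈ f.ker, x ^ ℓ ^ a = 1)
    (z : G) (hz : z ^ ℓ ∈ f.ker) (m : ℕ)
    (hcard : Nat.card {x : f.ker // z * x * z⁻¹ = x ∧ x ^ ℓ = 1} ≤ ℓ ^ m) :
    Group.rank G ≤ Group.rank f.range + 2 * m ∧
      ((∀ x ∈ f.ker, x ^ ℓ = 1) → Group.rank G ≤ Group.rank f.range + m) := by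
  classical
  let _ : CommGroup f.ker :=
    { (inferInstance : Group f.ker) with
      mul_comm := fun x y ↦ Subtype.ext (hK x x.2 y y.2) }
  set Z : AddMonoid.End (Additive f.ker) :=
    MonoidHom.toAdditive (MulAut.conjNormal z : MulAut f.ker).toMonoidHom
  have hZ : ∀ x : f.ker, ((Z (Additive.ofMul x)).toMul : G) = z * x * z⁻¹ := fun x ↦ rfl
  have hZpow : ∀ (n : ℕ) (x : f.ker),
      (((Z ^ n) (Additive.ofMul x)).toMul : G) = z ^ n * x * (z ^ n)⁻¹ := by
    intro n
    induction n with
    | zero => intro x; simp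
    | succ n ih =>
      intro x
      rw [pow_succ, AddMonoid.End.coe_mul, Function.comp_apply,
        ← ofMul_toMul (Z (Additive.ofMul x)), ih, hZ]
      group
  have hZℓ : Z ^ ℓ = 1 := by
    ext x
    have := hZpow ℓ x.toMul
    rw [hK _ hz _ x.toMul.2, mul_inv_cancel_right] at this
    exact this
  obtain ⟨k, hk⟩ := (hG.to_subgroup f.ker).exists_card_eq
  obtain ⟨T, hT₁, hT₂, hT⟩ := exists_finset_generating_of_pow_eq_one (M := Additive f.ker)
    (k := k) (a := a) hk (fun x ↦ Subtype.ext (ha _ x.toMul.2)) Z hZℓ m (by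
      refine le_trans (Nat.card_le_card_of_injective
        (Subtype.map (fun x ↦ x.toMul) fun x hx ↦ ?_) ?_) hcard
      · exact ⟨congrArg (fun y ↦ (y.toMul : G)) hx.1, hx.2⟩
      · exact Subtype.map_injective _ fun x y h ↦ h)
  have key : Group.rank G ≤ Group.rank f.range + T.card := by
    refine (rank_le_of_conj_generate_ker f hK z (T.image fun x ↦ (x.toMul : G)) ?_ ?_).trans
      (Nat.add_le_add_left Finset.card_image_le _)
    · intro x hx
      obtain ⟨y, -, rfl⟩ := Finset.mem_image.1 (Finset.mem_coe.1 hx)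
      exact y.toMul.2
    · intro L hLK hTL hL x hx
      have htop := hT (L.subgroupOf f.ker).toAddSubgroup (fun t ht ↦ ?_) (fun y hy ↦ ?_)
      · have hx' : Additive.ofMul (⟨x, hx⟩ : f.ker) ∈ (L.subgroupOf f.ker).toAddSubgroup :=
          htop ▸ AddSubgroup.mem_top _
        exact hx'
      · exact hTL (Finset.mem_coe.2 (Finset.mem_image_of_mem _ (Finset.mem_coe.1 ht)))
      · exact hL _ hy
  refine ⟨by omega, fun h ↦ ?_⟩
  have := hT₂ fun x ↦ Subtype.ext (h _ x.toMul.2)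
  omega

end KernelBound

/-! ### Semiregular permutations of prime order -/

section Permutation

variable {Ω : Type*} [Finite Ω] {ℓ : ℕ} [hℓ : Fact ℓ.Prime]

omit [Finite Ω] in
lemma card_eq_mul_card_orbits (σ : Equiv.Perm Ω) (hσ : σ ^ ℓ = 1) (hfix : ∀ x, σ x ≠ x) :
    Nat.card Ω = ℓ * Nat.card (MulAction.orbitRel.Quotient (Subgroup.zpowers σ) Ω) := by
  rcases isEmpty_or_nonempty Ω with h | ⟨⟨x⟩⟩
  · simp
  have hord : orderOf σ = ℓ := orderOf_eq_prime hσ fun h ↦ hfix x (by rw [h]; rfl)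
  have hZ : Nat.card (Subgroup.zpowers σ) = ℓ := by rw [Nat.card_zpowers, hord]
  have hst : ∀ b : Ω, MulAction.stabilizer (Subgroup.zpowers σ) b = ⊥ := by
    intro b
    have : Fact (Nat.card (Subgroup.zpowers σ)).Prime := ⟨hZ ▸ hℓ.out⟩
    refine ((MulAction.stabilizer (Subgroup.zpowers σ) b).eq_bot_or_eq_top_of_prime_card).resolve_right
      fun h ↦ hfix b ?_
    have : (⟨σ, Subgroup.mem_zpowers σ⟩ : Subgroup.zpowers σ) ∈
        MulAction.stabilizer (Subgroup.zpowers σ) b := h ▸ Subgroup.mem_top _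
    exact this
  rw [Nat.card_congr (MulAction.selfEquivOrbitsQuotientProd hst), Nat.card_prod, hZ, mul_comm]

/-- An invariant function is determined by one value per orbit, and a cyclic group has at most ℓ
elements killed by ℓ. -/
lemma card_invariant_torsion_le {A : Type*} [Group A] [Finite A] [IsCyclic A] (σ : Equiv.Perm Ω) :
    Nat.card {f : Ω → A // (∀ x, f (σ x) = f x) ∧ ∀ x, f x ^ ℓ = 1} ≤
      ℓ ^ Nat.card (MulAction.orbitRel.Quotient (Subgroup.zpowers σ) Ω) := by
  classical
  have hA : Nat.card {x : A // x ^ ℓ = 1} ≤ ℓ := by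
    have := Fintype.ofFinite A
    rw [Nat.card_eq_fintype_card, Fintype.card_subtype]
    exact IsCyclic.card_pow_eq_one_le hℓ.out.pos
  refine le_trans ?_ (Nat.pow_le_pow_left hA _)
  rw [← Nat.card_fun]
  refine Nat.card_le_card_of_injective (fun f q ↦ ⟨f.1 q.out, f.2.2 _⟩) fun f g hfg ↦ ?_
  have key : ∀ f : {f : Ω → A // (∀ x, f (σ x) = f x) ∧ ∀ x, f x ^ ℓ = 1}, ∀ x : Ω,
      f.1 (Quotient.out (s := MulAction.orbitRel (Subgroup.zpowers σ) Ω) (Quotient.mk _ x)) =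
        f.1 x := by
    intro f x
    obtain ⟨⟨_, j, rfl⟩, hj⟩ := (Quotient.mk_out (s := MulAction.orbitRel (Subgroup.zpowers σ) Ω) x)
    have hzpow : ∀ (j : ℤ) (x : Ω), f.1 ((σ ^ j) x) = f.1 x := by
      intro j
      induction j with
      | zero => intro x; rfl
      | succ n ih => intro x; rw [zpow_add_one, Equiv.Perm.mul_apply, ih, f.2.1]
      | pred n ih =>
        intro x
        rw [zpow_sub_one, Equiv.Perm.mul_apply, ih, ← f.2.1 (σ⁻¹ x), ← Equiv.Perm.mul_apply, mul_inv_cancel]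
        rfl
    rw [← hj]
    exact hzpow j x
  refine Subtype.ext (funext fun x ↦ ?_)
  rw [← key f x, ← key g x]
  exact congrArg Subtype.val (congrFun hfg (Quotient.mk _ x))

end Permutation

/-! ### Transitive actions of ℓ-groups -/

section Transitive

variable {G Ω : Type*} [Group G] [Finite G] [Finite Ω] {ℓ : ℕ} [hℓ : Fact ℓ.Prime]

-- The image of `ψ` is a nontrivial ℓ-group, so its centre has an element of order ℓ. A central
-- element fixing one point fixes all by transitivity.
omit [Finite Ω] in
lemma exists_central_fixedPointFree [Nontrivial Ω] (hG : IsPGroup ℓ G) (ψ : G →* Equiv.Perm Ω)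
    (htrans : ∀ x y, ∃ g, ψ g x = y) :
    ∃ z : G, (∀ g, ψ z * ψ g = ψ g * ψ z) ∧ ψ z ^ ℓ = 1 ∧ ∀ x, ψ z x ≠ x := by
  have hP : IsPGroup ℓ ψ.range := hG.of_surjective ψ.rangeRestrict ψ.rangeRestrict_surjective
  have : Finite ψ.range := Finite.of_surjective _ ψ.rangeRestrict_surjective
  have : Nontrivial ψ.range := by
    obtain ⟨x, y, hxy⟩ := exists_pair_ne Ω
    obtain ⟨g, hg⟩ := htrans x y
    refine ⟨⟨ψ g, g, rfl⟩, 1, fun h ↦ hxy ?_⟩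
    have h' : ψ g = 1 := congrArg Subtype.val h
    rw [← hg, h']
    rfl
  have := hP.center_nontrivial
  obtain ⟨n, hn, hcard⟩ := (IsPGroup.nontrivial_iff_card (hP.to_subgroup (Subgroup.center ψ.range))).1
    inferInstance
  obtain ⟨c, hc⟩ := exists_prime_orderOf_dvd_card' (G := Subgroup.center ψ.range) ℓ
    (by rw [hcard]; exact dvd_pow_self _ hn.ne')
  obtain ⟨z, hzc⟩ := c.1.2
  have hcomm : ∀ g, ψ z * ψ g = ψ g * ψ z := fun g ↦ by
    rw [hzc]
    exact (congrArg Subtype.val (Subgroup.mem_center_iff.1 c.2 ⟨ψ g, g, rfl⟩)).symm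
  have hne : ψ z ≠ 1 := by
    intro h
    have h1 : c = 1 := Subtype.ext (Subtype.ext (hzc.symm.trans h))
    rw [h1, orderOf_one] at hc
    exact hℓ.out.one_lt.ne hc
  refine ⟨z, hcomm, ?_, fun x hx ↦ hne ?_⟩
  · have hpow := hc ▸ pow_orderOf_eq_one c
    rw [hzc]
    exact congrArg (fun y : Subgroup.center ψ.range ↦ (y.1 : Equiv.Perm Ω)) hpow
  · ext y
    obtain ⟨g, rfl⟩ := htrans x y
    rw [← Equiv.Perm.mul_apply, hcomm, Equiv.Perm.mul_apply, hx]
    rfl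

/-- The contribution to `d(G)` of the kernel of a transitive action, when this kernel embeds
equivariantly into a permutation module with cyclic coefficients. -/
lemma rank_le_of_equivariant_embedding [Nontrivial Ω] {A : Type*} [CommGroup A] [Finite A]
    [IsCyclic A] (hG : IsPGroup ℓ G) (ψ : G →* Equiv.Perm Ω) (htrans : ∀ x y, ∃ g, ψ g x = y)
    {a : ℕ} (hA : ∀ x : A, x ^ ℓ ^ a = 1) (ι : ψ.ker →* (Ω → A)) (hι : Function.Injective ι)
    (hequiv : ∀ (g : G) (k k' : ψ.ker) (x : Ω), (k' : G) = g * k * g⁻¹ → ι k' (ψ g x) = ι k x) :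
    ∃ m, Nat.card Ω = ℓ * m ∧ Group.rank G ≤ Group.rank ψ.range + 2 * m ∧
      ((∀ x : A, x ^ ℓ = 1) → Group.rank G ≤ Group.rank ψ.range + m) := by
  obtain ⟨z, hz, hzℓ, hfix⟩ := exists_central_fixedPointFree hG ψ htrans
  refine ⟨_, card_eq_mul_card_orbits (ψ z) hzℓ hfix, ?_⟩
  have hpow : ∀ n : ℕ, (∀ x : A, x ^ n = 1) → ∀ x ∈ ψ.ker, x ^ n = 1 := by
    intro n hn x hx
    have : (⟨x, hx⟩ : ψ.ker) ^ n = 1 := hι (by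
      rw [map_pow, map_one]; exact funext fun y ↦ hn _)
    exact congrArg Subtype.val this
  have := rank_le_of_card_centralized_torsion hG ψ (fun x hx y hy ↦
    congrArg Subtype.val (hι (by rw [map_mul, map_mul, mul_comm]) :
      (⟨x, hx⟩ * ⟨y, hy⟩ : ψ.ker) = ⟨y, hy⟩ * ⟨x, hx⟩)) (hpow _ hA) z
    (by rw [MonoidHom.mem_ker, map_pow, hzℓ])
    (Nat.card (MulAction.orbitRel.Quotient (Subgroup.zpowers (ψ z)) Ω)) (by
      refine le_trans (Nat.card_le_card_of_injective (Subtype.map ι fun k hk ↦ ?_) ?_)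
        (card_invariant_torsion_le (A := A) (ψ z))
      -- Equivariance with `k' = k`: an element commuting with `z` becomes a function constant on
      -- the orbits of `ψ z`.
      · refine ⟨fun x ↦ hequiv z k k x hk.1.symm, fun x ↦ ?_⟩
        rw [← Pi.pow_apply, ← map_pow, hk.2, map_one, Pi.one_apply]
      · exact Subtype.map_injective _ hι)
  exact ⟨this.1, fun h ↦ this.2 (hpow _ h)⟩

end Transitive

lemma rank_le_one_of_isCyclic (G : Type*) [Group G] [Finite G] [IsCyclic G] :
    Group.rank G ≤ 1 := by
  obtain ⟨g, hg⟩ := IsCyclic.exists_generator (α := G)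
  have h : Subgroup.closure (({g} : Finset G) : Set G) = ⊤ := by
    rw [Finset.coe_singleton, ← Subgroup.zpowers_eq_closure]
    exact (Subgroup.eq_top_iff' _).2 hg
  simpa using Group.rank_le h

lemma rank_le_one_of_injective {K Q A : Type*} [Group K] [Finite K] [Group A] [IsCyclic A]
    [Subsingleton Q] (ι : K →* (Q → A)) (hι : Function.Injective ι) : Group.rank K ≤ 1 := by
  rcases isEmpty_or_nonempty Q with h | ⟨⟨q⟩⟩
  · have : Subsingleton K := hι.subsingleton
    simp [Group.rank_eq_zero]
  · have : IsCyclic K := isCyclic_of_injective ((Pi.evalMonoidHom (fun _ : Q ↦ A) q).comp ι)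
      fun x y h ↦ hι (funext fun q' ↦ by rw [Subsingleton.elim q' q]; exact h)
    exact rank_le_one_of_isCyclic K

/-! ### Reduction to transitive groups -/

section Reduction

/-- Every finite `ℓ`-group `G` of monomial permutations of `Ω` with entries in `A` satisfies
`q * d(G) ≤ p * |Ω|`. -/
def MonomialBound (ℓ : ℕ) (A : Type) [Group A] (p q : ℕ) (Ω : Type) : Prop :=
  ∀ (G : Type) [Group G] [Finite G], IsPGroup ℓ G →
    ∀ φ : G →* PermWreathProduct A (MonoidHom.id (Equiv.Perm Ω)), Function.Injective φ →
      q * Group.rank G ≤ p * Nat.card Ω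

variable {A : Type} [Group A] {Ω : Type}

lemma permWreathProduct_mul_left_apply {Q Ω : Type*} [Group Q] (π : Q →* Equiv.Perm Ω)
    (x y : PermWreathProduct A π) (ω : Ω) :
    (x * y).left ω = x.left ω * y.left ((π x.right)⁻¹ ω) := rfl

/-- The restriction of a monomial action to an invariant subset. -/
def restrictHom {G : Type*} [Group G] [MulAction G Ω]
    (φ : G →* PermWreathProduct A (MonoidHom.id (Equiv.Perm Ω)))
    (hφ : ∀ g x, (φ g).right x = g • x) (S : SubMulAction G Ω) :
    G →* PermWreathProduct A (MonoidHom.id (Equiv.Perm S)) where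
  toFun g := ⟨fun s ↦ (φ g).left s, MulAction.toPermHom G S g⟩
  map_one' := by
    refine SemidirectProduct.ext ?_ ?_
    · rw [map_one]; rfl
    · exact map_one (MulAction.toPermHom G S)
  map_mul' g h := by
    refine SemidirectProduct.ext (funext fun s ↦ ?_) ?_
    · rw [map_mul]
      change (φ g).left s * (φ h).left ((φ g).right⁻¹ (s : Ω)) =
        (φ g).left s * (φ h).left ((g⁻¹ • s : S) : Ω)
      rw [SubMulAction.val_smul, ← hφ, map_inv]
      rfl
    · exact map_mul (MulAction.toPermHom G S) g h

/-- A bound on `d(G)` proportional to the degree reduces to transitive groups. -/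
lemma monomialBound_of_transitive {ℓ p q : ℕ}
    (htr : ∀ (Ω : Type) [Finite Ω],
      (∀ (Ω' : Type) [Finite Ω'], Nat.card Ω' < Nat.card Ω → MonomialBound ℓ A p q Ω') →
      ∀ (G : Type) [Group G] [Finite G], IsPGroup ℓ G →
        ∀ φ : G →* PermWreathProduct A (MonoidHom.id (Equiv.Perm Ω)), Function.Injective φ →
          (∀ x y, ∃ g, (φ g).right x = y) → q * Group.rank G ≤ p * Nat.card Ω)
    (Ω : Type) [Finite Ω] : MonomialBound ℓ A p q Ω := by
  classical
  induction hn : Nat.card Ω using Nat.strong_induction_on generalizing Ω with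
  | _ n ih =>
  subst hn
  intro G _ _ hG φ hφ
  by_cases ht : ∀ x y, ∃ g, (φ g).right x = y
  · exact htr Ω (fun Ω' _ hΩ' ↦ ih _ hΩ' Ω' rfl) G hG φ hφ ht
  push Not at ht
  obtain ⟨x, y, hxy⟩ := ht
  let _ : MulAction G Ω := MulAction.compHom Ω (SemidirectProduct.rightHom.comp φ)
  have hact : ∀ (g : G) (x : Ω), (φ g).right x = g • x := fun g x ↦ rfl
  -- `G` is an extension of its image on the orbit `S` by a group acting faithfully on the
  -- complement; both have smaller degree.
  let S : SubMulAction G Ω := ⟨MulAction.orbit G x, fun g _ hy ↦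
    MulAction.mem_orbit_of_mem_orbit g hy⟩
  have hS : Nat.card S + Nat.card (Sᶜ : SubMulAction G Ω) = Nat.card Ω := by
    rw [← Nat.card_congr (Equiv.Set.sumCompl (S : Set Ω)), Nat.card_sum]
    rfl
  have hx : x ∈ S := MulAction.mem_orbit_self x
  have hy : y ∈ (Sᶜ : SubMulAction G Ω) := by
    rintro ⟨g, hg⟩
    exact hxy g hg
  have hS₁ : 0 < Nat.card S := Nat.card_pos_iff.2 ⟨⟨⟨x, hx⟩⟩, inferInstance⟩
  have hS₂ : 0 < Nat.card (Sᶜ : SubMulAction G Ω) :=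
    Nat.card_pos_iff.2 ⟨⟨⟨y, hy⟩⟩, inferInstance⟩
  set φ₁ := restrictHom φ hact S
  have hfin : Finite φ₁.range := Finite.of_surjective _ φ₁.rangeRestrict_surjective
  set φ₂ := (restrictHom φ hact Sᶜ).comp φ₁.ker.subtype
  have hinj : Function.Injective φ₂ := by
    rw [injective_iff_map_eq_one]
    rintro ⟨g, hg⟩ hg'
    refine Subtype.ext (hφ ?_)
    have h₁ : φ₁ g = 1 := hg
    have h₂ : restrictHom φ hact Sᶜ g = 1 := hg'
    change φ g = φ 1
    rw [map_one]
    refine SemidirectProduct.ext (funext fun w ↦ ?_) (Equiv.ext fun w ↦ ?_)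
    · by_cases hw : w ∈ S
      · exact congrFun (congrArg SemidirectProduct.left h₁) ⟨w, hw⟩
      · exact congrFun (congrArg SemidirectProduct.left h₂) ⟨w, hw⟩
    · by_cases hw : w ∈ S
      · exact congrArg Subtype.val
          (DFunLike.congr_fun (congrArg SemidirectProduct.right h₁) ⟨w, hw⟩)
      · exact congrArg Subtype.val
          (DFunLike.congr_fun (congrArg SemidirectProduct.right h₂) ⟨w, hw⟩)
  have b₁ := ih _ (by omega) S rfl φ₁.range
    (hG.of_surjective φ₁.rangeRestrict φ₁.rangeRestrict_surjective) φ₁.range.subtype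
    φ₁.range.subtype_injective
  have b₂ := ih _ (by omega) (Sᶜ : SubMulAction G Ω) rfl φ₁.ker (hG.to_subgroup _) φ₂ hinj
  have b₃ := rank_le_rank_range_add_rank_ker φ₁
  calc q * Group.rank G ≤ q * (Group.rank φ₁.range + Group.rank φ₁.ker) :=
        Nat.mul_le_mul_left _ b₃
    _ ≤ p * Nat.card S + p * Nat.card (Sᶜ : SubMulAction G Ω) := by rw [mul_add]; omega
    _ = p * Nat.card Ω := by rw [← mul_add, hS]

end Reduction

/-! ### Permutation ℓ-groups -/

section Perm

variable {ℓ : ℕ} [hℓ : Fact ℓ.Prime]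

/-- The action on the orbits of a permutation `σ` centralized by the image of `ψ`. -/
def orbitsHom {G Ω : Type*} [Group G] (ψ : G →* Equiv.Perm Ω) (σ : Equiv.Perm Ω)
    (hσ : ∀ g, ∀ s ∈ Subgroup.zpowers σ, ∀ x, s (ψ g x) = ψ g (s x)) :
    G →* Equiv.Perm (MulAction.orbitRel.Quotient (Subgroup.zpowers σ) Ω) where
  toFun g := Quotient.congr (ψ g) fun x y ↦ by
    refine ⟨?_, ?_⟩
    · rintro ⟨s, rfl⟩
      exact ⟨s, hσ g s s.2 y⟩
    · rintro ⟨s, hs⟩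
      exact ⟨s, (ψ g).injective ((hσ g s s.2 y).symm.trans hs)⟩
  map_one' := Equiv.ext fun q ↦ Quotient.inductionOn q fun x ↦ by
    change Quotient.mk _ (ψ 1 x) = Quotient.mk _ x
    rw [map_one]; rfl
  map_mul' g h := Equiv.ext fun q ↦ Quotient.inductionOn q fun x ↦ by
    change Quotient.mk _ (ψ (g * h) x) = Quotient.mk _ (ψ g (ψ h x))
    rw [map_mul]; rfl

/-- The kernel of the action on the orbits of a central semiregular permutation `σ` embeds
equivariantly into the permutation module of these orbits over `⟨σ⟩`. -/
lemma exists_equivariant_embedding_ker_orbitsHom {G Ω : Type*} [Group G] (ψ : G →* Equiv.Perm Ω)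
    (hψ : Function.Injective ψ) (σ : Equiv.Perm Ω)
    (hσ : ∀ g, ∀ s ∈ Subgroup.zpowers σ, ∀ x, s (ψ g x) = ψ g (s x))
    (hfree : ∀ s ∈ Subgroup.zpowers σ, ∀ t ∈ Subgroup.zpowers σ, ∀ x, s x = t x → s = t) :
    ∃ ι : (orbitsHom ψ σ hσ).ker →*
        (MulAction.orbitRel.Quotient (Subgroup.zpowers σ) Ω → Subgroup.zpowers σ),
      Function.Injective ι ∧ ∀ (g : G) (k k' : (orbitsHom ψ σ hσ).ker) x,
        (k' : G) = g * k * g⁻¹ → ι k' (orbitsHom ψ σ hσ g x) = ι k x := by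
  set Q := MulAction.orbitRel.Quotient (Subgroup.zpowers σ) Ω
  -- An element preserving an orbit of `⟨σ⟩` and commuting with `⟨σ⟩` acts on that orbit as a single
  -- power of `σ`.
  have hex : ∀ (k : (orbitsHom ψ σ hσ).ker) (q : Q), ∃ s : Subgroup.zpowers σ,
      ∀ x : Ω, (Quotient.mk _ x : Q) = q → s.1 x = ψ k x := by
    intro k q
    induction q using Quotient.inductionOn with
    | _ x =>
    have hk : (Quotient.mk _ (ψ k x) : Q) = Quotient.mk _ x :=
      DFunLike.congr_fun (k.2 : orbitsHom ψ σ hσ k = 1) (Quotient.mk _ x)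
    obtain ⟨s, hs⟩ := Quotient.exact hk
    refine ⟨s, fun y hy ↦ ?_⟩
    obtain ⟨t, rfl⟩ := Quotient.exact hy
    change s.1 (t.1 x) = ψ k (t.1 x)
    rw [← hσ _ _ t.2, ← hs]
    exact congrArg (fun u : Subgroup.zpowers σ ↦ u.1 x) (mul_comm' s t)
  choose s hs using hex
  have huniq : ∀ (k : (orbitsHom ψ σ hσ).ker) (x : Ω) (t : Subgroup.zpowers σ),
      t.1 x = ψ k x → s k (Quotient.mk _ x) = t := fun k x t h ↦
    Subtype.ext (hfree _ (s k _).2 _ t.2 x ((hs k _ x rfl).trans h.symm))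
  refine ⟨⟨⟨s, ?_⟩, ?_⟩, ?_, ?_⟩
  · funext q
    induction q using Quotient.inductionOn with
    | _ x => exact huniq _ x _ (by simp)
  · intro k l
    funext q
    induction q using Quotient.inductionOn with
    | _ x =>
    refine huniq _ x _ ?_
    change (s k (Quotient.mk _ x) * s l (Quotient.mk _ x)).1 x = _
    rw [mul_comm']
    change (s l (Quotient.mk _ x)).1 ((s k (Quotient.mk _ x)).1 x) = _
    rw [hs k _ x rfl, hσ _ _ (s l _).2, hs l _ x rfl, Subgroup.coe_mul, map_mul,
      Equiv.Perm.mul_apply]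
  · intro k l hkl
    refine Subtype.ext (hψ (Equiv.ext fun x ↦ ?_))
    rw [← hs k _ x rfl, ← hs l _ x rfl]
    exact congrArg (fun t : Subgroup.zpowers σ ↦ t.1 x) (congrFun hkl (Quotient.mk _ x))
  · intro g k k' q h
    induction q using Quotient.inductionOn with
    | _ x =>
    refine huniq k' (ψ g x) _ ?_
    change (s k (Quotient.mk _ x)).1 (ψ g x) = _
    rw [hσ _ _ (s k _).2, hs k _ x rfl, h]
    simp

-- Let `Q` be the set of orbits of a central `σ` of order ℓ, so `|Ω| = ℓ|Q|`. If `|Q| = ℓm`, the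
-- kernel on `Q` is elementary abelian and costs `m` generators, the image on `Q` costs `m` by
-- induction, and `2m ≤ ℓm = |Q|`. If `Q` is a point, `G` is cyclic.
open scoped IsMulCommutative in
lemma card_mul_rank_le_of_transitive (Ω : Type) [Finite Ω]
    (IH : ∀ (Ω' : Type) [Finite Ω'], Nat.card Ω' < Nat.card Ω → ∀ (G : Type) [Group G] [Finite G],
      IsPGroup ℓ G → ∀ ψ : G →* Equiv.Perm Ω', Function.Injective ψ →
        ℓ * Group.rank G ≤ Nat.card Ω')
    (G : Type) [Group G] [Finite G] (hG : IsPGroup ℓ G) (ψ : G →* Equiv.Perm Ω)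
    (hψ : Function.Injective ψ) (htrans : ∀ x y, ∃ g, ψ g x = y) :
    ℓ * Group.rank G ≤ Nat.card Ω := by
  classical
  rcases subsingleton_or_nontrivial Ω with hΩ | hΩ
  · have : Subsingleton G := hψ.subsingleton
    simp [Group.rank_eq_zero]
  obtain ⟨z, hz, hzℓ, hfix⟩ := exists_central_fixedPointFree hG ψ htrans
  have hσ : ∀ g, ∀ s ∈ Subgroup.zpowers (ψ z), ∀ x, s (ψ g x) = ψ g (s x) := by
    rintro g _ ⟨j, rfl⟩ x
    exact DFunLike.congr_fun ((show Commute (ψ z) (ψ g) from hz g).zpow_left j) x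
  have hfree : ∀ s ∈ Subgroup.zpowers (ψ z), ∀ t ∈ Subgroup.zpowers (ψ z), ∀ x,
      s x = t x → s = t := by
    rintro _ ⟨i, rfl⟩ _ ⟨j, rfl⟩ x h
    have hc : ∀ i : ℤ, ∀ g, ((ψ z) ^ i) (ψ g x) = ψ g (((ψ z) ^ i) x) := fun i g ↦
      hσ g _ ⟨i, rfl⟩ x
    ext y
    obtain ⟨g, rfl⟩ := htrans x y
    have h' : ((ψ z) ^ i) x = ((ψ z) ^ j) x := h
    simp only [hc, h']
  have hcard := card_eq_mul_card_orbits (ψ z) hzℓ hfix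
  set Q := MulAction.orbitRel.Quotient (Subgroup.zpowers (ψ z)) Ω
  set ψ' := orbitsHom ψ (ψ z) hσ
  obtain ⟨ι, hι, hequiv⟩ : ∃ ι : ψ'.ker →* (Q → Subgroup.zpowers (ψ z)), Function.Injective ι ∧
      ∀ (g : G) (k k' : ψ'.ker) x, (k' : G) = g * k * g⁻¹ → ι k' (ψ' g x) = ι k x :=
    exists_equivariant_embedding_ker_orbitsHom ψ hψ (ψ z) hσ hfree
  have hfin : Finite ψ'.range := Finite.of_surjective _ ψ'.rangeRestrict_surjective
  have hQpos : 0 < Nat.card Q := Nat.card_pos_iff.2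
    ⟨(inferInstance : Nonempty Ω).map (Quotient.mk _), inferInstance⟩
  rcases subsingleton_or_nontrivial Q with hQ | hQ
  · have h₁ := rank_le_one_of_injective ι hι
    have h₂ : Group.rank ψ'.range = 0 := Group.rank_eq_zero _
    have h₃ := rank_le_rank_range_add_rank_ker ψ'
    rw [hcard]
    exact Nat.mul_le_mul_left _ (by omega)
  · have htrans' : ∀ x y, ∃ g, ψ' g x = y := by
      intro x y
      induction x using Quotient.inductionOn with
      | _ x =>
      induction y using Quotient.inductionOn with
      | _ y =>
      obtain ⟨g, rfl⟩ := htrans x y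
      exact ⟨g, rfl⟩
    have hA : ∀ x : Subgroup.zpowers (ψ z), x ^ ℓ = 1 := by
      rintro ⟨_, j, rfl⟩
      refine Subtype.ext ?_
      change ((ψ z) ^ j) ^ ℓ = 1
      rw [← zpow_natCast, ← zpow_mul, mul_comm, zpow_mul, zpow_natCast, hzℓ, one_zpow]
    obtain ⟨m, hm, -, hr⟩ := rank_le_of_equivariant_embedding (a := 1) hG ψ' htrans'
      (fun x ↦ by rw [pow_one]; exact hA x) ι hι hequiv
    have hr := hr hA
    have h₁ := IH Q (by rw [hcard]; exact lt_mul_of_one_lt_left hQpos hℓ.out.one_lt) ψ'.range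
      (hG.of_surjective ψ'.rangeRestrict ψ'.rangeRestrict_surjective) ψ'.range.subtype
      ψ'.range.subtype_injective
    rw [hm] at h₁
    have h₂ := Nat.le_of_mul_le_mul_left h₁ hℓ.out.pos
    rw [hcard, hm]
    refine Nat.mul_le_mul_left _ (hr.trans ?_)
    nlinarith [hℓ.out.two_le]

/-- A permutation `ℓ`-group of degree `n` is generated by at most `n / ℓ` elements. -/
lemma mul_rank_le_card (Ω : Type) [Finite Ω] (G : Type) [Group G] [Finite G] (hG : IsPGroup ℓ G)
    (ψ : G →* Equiv.Perm Ω) (hψ : Function.Injective ψ) : ℓ * Group.rank G ≤ Nat.card Ω := by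
  -- Permutation groups are monomial groups with trivial entries, so the reduction to transitive
  -- groups applies.
  have hperm : ∀ (Ω : Type), MonomialBound ℓ Unit 1 ℓ Ω → ∀ (G : Type) [Group G] [Finite G],
      IsPGroup ℓ G → ∀ ψ : G →* Equiv.Perm Ω, Function.Injective ψ →
        ℓ * Group.rank G ≤ Nat.card Ω := by
    intro Ω h G _ _ hG ψ hψ
    simpa using h G hG ((SemidirectProduct.inr (N := Ω → Unit)).comp ψ)
      (SemidirectProduct.inr_injective.comp hψ)
  refine hperm Ω (monomialBound_of_transitive (fun Ω _ IH G _ _ hG φ hφ ht ↦ ?_) Ω) G hG ψ hψ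
  rw [one_mul]
  refine card_mul_rank_le_of_transitive Ω (fun Ω' _ hΩ' ↦ hperm Ω' (IH Ω' hΩ')) G hG
    (SemidirectProduct.rightHom.comp φ) (fun x y h ↦ hφ ?_) ht
  exact SemidirectProduct.ext (Subsingleton.elim _ _) h

end Perm

/-! ### Monomial ℓ-groups with cyclic entries -/

section Monomial

variable {ℓ : ℕ} [hℓ : Fact ℓ.Prime] {A : Type} [CommGroup A] [Finite A] [IsCyclic A]

/-- Transitive monomial `ℓ`-groups with cyclic entries. -/
lemma rank_monomial_le_of_transitive {a : ℕ} (hA : ∀ x : A, x ^ ℓ ^ a = 1) (Ω : Type) [Finite Ω]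
    (G : Type) [Group G] [Finite G] (hG : IsPGroup ℓ G)
    (φ : G →* PermWreathProduct A (MonoidHom.id (Equiv.Perm Ω))) (hφ : Function.Injective φ)
    (htrans : ∀ x y, ∃ g, (φ g).right x = y) :
    Group.rank G ≤ Nat.card Ω ∧ Subsingleton Ω ∨ ∃ m, Nat.card Ω = ℓ * m ∧ Group.rank G ≤ 3 * m ∧
      ((∀ x : A, x ^ ℓ = 1) → Group.rank G ≤ 2 * m) := by
  set ψ : G →* Equiv.Perm Ω := SemidirectProduct.rightHom.comp φ
  have hker : ∀ k : ψ.ker, (φ k).right = 1 := fun k ↦ k.2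
  have hfin : Finite ψ.range := Finite.of_surjective _ ψ.rangeRestrict_surjective
  let ι : ψ.ker →* (Ω → A) :=
    { toFun := fun k ↦ (φ k).left
      map_one' := by rw [Subgroup.coe_one, map_one]; rfl
      map_mul' := fun k l ↦ by
        funext x
        rw [Subgroup.coe_mul, map_mul, permWreathProduct_mul_left_apply, hker]
        rfl }
  have hι : Function.Injective ι := fun k l h ↦
    Subtype.ext (hφ (SemidirectProduct.ext h ((hker k).trans (hker l).symm)))
  rcases subsingleton_or_nontrivial Ω with hΩ | hΩ
  · left
    refine ⟨?_, hΩ⟩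
    rcases isEmpty_or_nonempty Ω with h | h
    · have : Subsingleton G := ⟨fun x y ↦ hφ (SemidirectProduct.ext
        (Subsingleton.elim _ _) (Subsingleton.elim _ _))⟩
      simp [Group.rank_eq_zero]
    · have h₁ := rank_le_one_of_injective ι hι
      have h₂ : Group.rank ψ.range = 0 := Group.rank_eq_zero _
      have h₃ := rank_le_rank_range_add_rank_ker ψ
      have h₄ : 0 < Nat.card Ω := Nat.card_pos
      omega
  · right
    obtain ⟨m, hm, h₁, h₂⟩ := rank_le_of_equivariant_embedding hG ψ htrans hA ι hι (by
      intro g k k' x h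
      change (φ k').left ((φ g).right x) = (φ k).left x
      have h' : φ k' * φ g = φ g * φ k := by
        rw [h, ← map_mul, ← map_mul, inv_mul_cancel_right]
      have := congrFun (congrArg SemidirectProduct.left h') ((φ g).right x)
      rw [permWreathProduct_mul_left_apply, permWreathProduct_mul_left_apply, hker, mul_comm] at this
      have h₁ : (MonoidHom.id (Equiv.Perm Ω)) (φ g).right = (φ g).right := rfl
      rw [h₁, ← Equiv.Perm.mul_apply (φ g).right⁻¹, inv_mul_cancel, map_one, inv_one] at this
      exact mul_left_cancel this)
    have h₃ := mul_rank_le_card Ω ψ.range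
      (hG.of_surjective ψ.rangeRestrict ψ.rangeRestrict_surjective) ψ.range.subtype
      ψ.range.subtype_injective
    rw [hm] at h₃
    have h₃ := Nat.le_of_mul_le_mul_left h₃ hℓ.out.pos
    exact ⟨m, hm, by omega, fun h ↦ by have := h₂ h; omega⟩

lemma monomialBound_one {a : ℕ} (hA : ∀ x : A, x ^ ℓ ^ a = 1)
    (h : ℓ ≠ 2 ∨ ∀ x : A, x ^ ℓ = 1) (Ω : Type) [Finite Ω] : MonomialBound ℓ A 1 1 Ω := by
  refine monomialBound_of_transitive (fun Ω _ _ G _ _ hG φ hφ ht ↦ ?_) Ω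
  rw [one_mul, one_mul]
  obtain ⟨h₁, -⟩ | ⟨m, hm, h₁, h₂⟩ := rank_monomial_le_of_transitive hA Ω G hG φ hφ ht
  · exact h₁
  · rw [hm]
    have h2 := hℓ.out.two_le
    -- Either ℓ ≥ 3 and `3m ≤ ℓm`, or the entries have exponent dividing ℓ and `2m ≤ ℓm`.
    rcases h with h | h
    · exact h₁.trans (Nat.mul_le_mul_right _ (by omega))
    · exact (h₂ h).trans (Nat.mul_le_mul_right _ h2)

lemma monomialBound_two {a : ℕ} (hA : ∀ x : A, x ^ 2 ^ a = 1) (Ω : Type) [Finite Ω] :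
    MonomialBound 2 A 3 2 Ω := by
  refine monomialBound_of_transitive (fun Ω _ _ G _ _ hG φ hφ ht ↦ ?_) Ω
  obtain ⟨h₁, -⟩ | ⟨m, hm, h₁, h₂⟩ := rank_monomial_le_of_transitive hA Ω G hG φ hφ ht
  · omega
  · omega

end Monomial

/-! ### Lower bound from the base group -/

section Lower

lemma card_le_rank_multiplicative_pi (I : Type*) [Finite I] (ℓ : ℕ) [Fact ℓ.Prime] :
    Nat.card I ≤ Group.rank (Multiplicative (I → ZMod ℓ)) := by
  classical
  have := Fintype.ofFinite I
  obtain ⟨S, hS, hS'⟩ := Group.rank_spec (Multiplicative (I → ZMod ℓ))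
  set S' : Finset (I → ZMod ℓ) := S.image Multiplicative.toAdd
  have hspan : Submodule.span (ZMod ℓ) (S' : Set (I → ZMod ℓ)) = ⊤ := by
    refine Submodule.eq_top_iff'.2 fun x ↦ ?_
    have hle : Subgroup.closure (S : Set (Multiplicative (I → ZMod ℓ))) ≤
        (Submodule.span (ZMod ℓ) (S' : Set (I → ZMod ℓ))).toAddSubgroup.toSubgroup := by
      rw [Subgroup.closure_le]
      intro s hs
      change s.toAdd ∈ Submodule.span (ZMod ℓ) (S' : Set (I → ZMod ℓ))
      exact Submodule.subset_span (Finset.mem_coe.2 (Finset.mem_image_of_mem _ hs))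
    exact hle (hS' ▸ Subgroup.mem_top (Multiplicative.ofAdd x))
  have h := finrank_span_finset_le_card (R := ZMod ℓ) S'
  rw [Set.finrank, hspan, finrank_top, Module.finrank_fintype_fun_eq_card,
    ← Nat.card_eq_fintype_card] at h
  exact h.trans (Finset.card_image_le.trans hS.le)

/-- `R` is the graph of a surjection from a subgroup of `X` onto `V`. Using a relation avoids
defining that homomorphism by choices. -/
lemma rank_le_subgroupRank {X V : Type*} [Group X] [Finite X] [Group V] [Finite V]
    (R : Subgroup (X × V)) (hinj : ∀ v, ((1, v) : X × V) ∈ R → v = 1)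
    (hsurj : ∀ v, ∃ x, (x, v) ∈ R) : (Group.rank V : ℕ∞) ≤ subgroupRank X := by
  let f : R →* X := (MonoidHom.fst X V).comp R.subtype
  have hf : Function.Injective f := by
    rw [injective_iff_map_eq_one]
    rintro ⟨⟨x, v⟩, h⟩ hx
    obtain rfl : x = 1 := hx
    obtain rfl := hinj v h
    rfl
  have h₁ : Group.rank V ≤ Group.rank R := Group.rank_le_of_surjective
    ((MonoidHom.snd X V).comp R.subtype) fun v ↦ by
      obtain ⟨x, hx⟩ := hsurj v
      exact ⟨⟨_, hx⟩, rfl⟩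
  rw [Group.rank_congr (MonoidHom.ofInjective hf)] at h₁
  exact (Nat.cast_le.2 h₁).trans (le_iSup (fun H : Subgroup X ↦ (Group.rank H : ℕ∞)) f.range)

lemma card_le_subgroupRank {Q Ω : Type*} [Group Q] [Finite Q] [Finite Ω] (π : Q →* Equiv.Perm Ω)
    (ℓ a : ℕ) [hℓ : Fact ℓ.Prime] (ha : a ≠ 0) [Finite (CyclicGrp (ℓ ^ a))] :
    (Nat.card Ω : ℕ∞) ≤ subgroupRank (PermWreathProduct (CyclicGrp (ℓ ^ a)) π) := by
  have hdvd : ℓ ∣ ℓ ^ a := dvd_pow_self _ ha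
  let red : (Ω → CyclicGrp (ℓ ^ a)) →* Multiplicative (Ω → ZMod ℓ) :=
    { toFun := fun f ↦ Multiplicative.ofAdd fun x ↦ ZMod.castHom hdvd (ZMod ℓ) (f x).toAdd
      map_one' := by
        refine congrArg Multiplicative.ofAdd (funext fun x ↦ ?_)
        exact map_zero (ZMod.castHom hdvd (ZMod ℓ))
      map_mul' := fun f g ↦ by
        refine congrArg Multiplicative.ofAdd (funext fun x ↦ ?_)
        exact map_add (ZMod.castHom hdvd (ZMod ℓ)) _ _ }
  have hred : Function.Surjective red := by
    intro v
    choose f hf using fun x ↦ ZMod.castHom_surjective hdvd (v.toAdd x)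
    exact ⟨fun x ↦ Multiplicative.ofAdd (f x),
      congrArg Multiplicative.ofAdd (funext fun x ↦ hf x)⟩
  refine (Nat.cast_le.2 (card_le_rank_multiplicative_pi Ω ℓ)).trans
    (rank_le_subgroupRank ((SemidirectProduct.inl.prod red).range) ?_ fun v ↦ ?_)
  · rintro v ⟨f, hf⟩
    have h₁ : f = 1 := SemidirectProduct.inl_injective ((congrArg Prod.fst hf).trans (map_one _).symm)
    have h₂ : red f = v := congrArg Prod.snd hf
    rw [← h₂, h₁, map_one]
  · obtain ⟨f, rfl⟩ := hred v
    exact ⟨_, f, rfl⟩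

lemma iteratedWreathToPermHom_succ_apply {G : Type*} [Group G] (n : ℕ)
    (w : RegularWreathProduct (IteratedWreathProduct G n) G) (x : Fin (n + 1) → G) :
    iteratedWreathToPermHom G (n + 1) w x =
      Fin.snoc (α := fun _ ↦ G)
        (iteratedWreathToPermHom G n (w.left (w.right * x (Fin.last n))) (Fin.init x))
        (w.right * x (Fin.last n)) := by
  refine Eq.trans ?_ (Fin.append_right_eq_snoc _ (fun _ : Fin 1 ↦ w.right * x (Fin.last n)))
  rfl

/-- Every permutation translating the first coordinate by a function of the others belongs to the
iterated wreath product. -/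
lemma exists_iteratedWreathToPermHom_eq_cons {G : Type*} [Group G] (s : ℕ)
    (u : (Fin s → G) → G) :
    ∃ w : IteratedWreathProduct G (s + 1), ∀ x : Fin (s + 1) → G,
      iteratedWreathToPermHom G (s + 1) w x =
        Fin.cons (α := fun _ ↦ G) (u (Fin.tail x) * x 0) (Fin.tail x) := by
  induction s with
  | zero =>
    refine ⟨(⟨1, u Fin.elim0⟩ : RegularWreathProduct (IteratedWreathProduct G 0) G), fun x ↦ ?_⟩
    rw [iteratedWreathToPermHom_succ_apply]
    funext i
    rw [show i = 0 from Fin.ext (by omega)]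
    change Fin.snoc (α := fun _ ↦ G) _ _ (Fin.last 0) = _
    rw [Fin.snoc_last, Fin.cons_zero]
    change u Fin.elim0 * x 0 = _
    rw [Subsingleton.elim (Fin.tail x) Fin.elim0]
  | succ s ih =>
    -- The top factor acts on the last coordinate. With trivial top component, the value `q` there
    -- selects the element `w q` acting on the other coordinates.
    choose w hw using fun q : G ↦ ih fun t ↦ u (Fin.snoc (α := fun _ ↦ G) t q)
    refine ⟨(⟨w, 1⟩ : RegularWreathProduct (IteratedWreathProduct G (s + 1)) G), fun x ↦ ?_⟩
    rw [iteratedWreathToPermHom_succ_apply]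
    simp only [one_mul]
    rw [hw, ← Fin.cons_snoc_eq_snoc_cons]
    have h : Fin.snoc (α := fun _ ↦ G) (Fin.tail (Fin.init x)) (x (Fin.last (s + 1))) =
        Fin.tail x := by
      rw [Fin.tail_init_eq_init_tail]
      exact Fin.snoc_init_self (Fin.tail x)
    rw [h]
    rfl

end Lower

lemma card_cyclicGrp (n : ℕ) : Nat.card (CyclicGrp n) = n :=
  (Nat.card_congr Multiplicative.toAdd).trans (Nat.card_zmod n)

/-! ### Central products of C₄ and D₄ in the case ℓ = 2 -/

section TwoLower

/-- `val` is additive up to even numbers, and `2c` kills these. -/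
lemma two_mul_val_add {n : ℕ} {c : ZMod n} (hc : 4 * c = 0) (e u : ZMod 2) :
    2 * c * ((e + u).val : ZMod n) = 2 * c * ((e.val : ZMod n) + (u.val : ZMod n)) := by
  have h : ∀ e u : ZMod 2, ∃ k : ℕ, e.val + u.val = (e + u).val + 2 * k := by
    intro e u
    refine ⟨(e.val + u.val) / 2, ?_⟩
    rw [ZMod.val_add]
    omega
  obtain ⟨k, hk⟩ := h e u
  rw [← Nat.cast_add, hk]
  push_cast
  linear_combination -(k : ZMod n) * hc

lemma intCast_zmod_two_eq_zero_of_mul {a : ℕ} (ha : 2 ≤ a) (p k : ℤ)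
    (h : ((2 ^ (a - 2) : ℕ) : ZMod (2 ^ a)) * ((k * p : ℤ) : ZMod (2 ^ a)) = 0)
    (hk : k = 1 ∨ k = 2) : (p : ZMod 2) = 0 := by
  rw [ZMod.intCast_zmod_eq_zero_iff_dvd]
  have h' : (((2 ^ (a - 2) : ℕ) * (k * p) : ℤ) : ZMod (2 ^ a)) = 0 := by
    rw [← h]; push_cast; ring
  rw [ZMod.intCast_zmod_eq_zero_iff_dvd] at h'
  obtain ⟨b, rfl⟩ := Nat.exists_eq_add_of_le ha
  have h2 : ((2 ^ (2 + b) : ℕ) : ℤ) = ((2 ^ b : ℕ) : ℤ) * 4 := by push_cast; ring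
  rw [Nat.add_sub_cancel_left, h2] at h'
  have h4 : (4 : ℤ) ∣ k * p := Int.dvd_of_mul_dvd_mul_left (by positivity) h'
  rcases hk with rfl | rfl <;> push_cast <;> omega

/-- Translation of the first coordinate by a function of the others. -/
abbrev shiftHead {s : ℕ} (u : (Fin s → CyclicGrp 2) → ZMod 2) (x : Fin (s + 1) → CyclicGrp 2) :
    Fin (s + 1) → CyclicGrp 2 :=
  Fin.cons (α := fun _ ↦ CyclicGrp 2) (Multiplicative.ofAdd (u (Fin.tail x)) * x 0) (Fin.tail x)

lemma shiftHead_shiftHead {s : ℕ} (u u' : (Fin s → CyclicGrp 2) → ZMod 2)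
    (x : Fin (s + 1) → CyclicGrp 2) : shiftHead u (shiftHead u' x) = shiftHead (u + u') x := by
  simp only [shiftHead, Fin.tail_cons, Fin.cons_zero, Pi.add_apply, ofAdd_add, mul_assoc]

lemma shiftHead_zero {s : ℕ} (x : Fin (s + 1) → CyclicGrp 2) : shiftHead 0 x = x := by
  simp [shiftHead]

lemma inv_apply_eq_shiftHead {s : ℕ} {σ : Equiv.Perm (Fin (s + 1) → CyclicGrp 2)}
    {u : (Fin s → CyclicGrp 2) → ZMod 2} (hσ : ∀ x, σ x = shiftHead u x)
    (x : Fin (s + 1) → CyclicGrp 2) : σ⁻¹ x = shiftHead u x := by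
  rw [Equiv.Perm.inv_eq_iff_eq, hσ, shiftHead_shiftHead]
  have : u + u = 0 := funext fun t ↦ CharTwo.add_self_eq_zero _
  rw [this, shiftHead_zero]

/-- Over each pair of points differing in the first coordinate, the elements of this relation lie
in a central product of `C₄` and `D₄`; the second component records their image in the
Frattini quotient. -/
def frattiniRelation {Q : Type*} [Group Q] {s : ℕ}
    (π : Q →* Equiv.Perm (Fin (s + 1) → CyclicGrp 2)) {n : ℕ} (c : ZMod n) (hc : 4 * c = 0) :
    Subgroup (PermWreathProduct (CyclicGrp n) π ×
      Multiplicative ((Fin s → CyclicGrp 2) × Fin 3 → ZMod 2)) where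
  carrier := {y | ∃ p q : (Fin s → CyclicGrp 2) → ℤ,
    (∀ t, y.2.toAdd (t, 0) = p t) ∧ (∀ t, y.2.toAdd (t, 1) = q t) ∧
    (∀ x, π y.1.right x = shiftHead (fun t ↦ y.2.toAdd (t, 2)) x) ∧
    ∀ x, (y.1.left x).toAdd =
      c * (p (Fin.tail x) + 2 * q (Fin.tail x) * ((x 0).toAdd.val : ZMod n))}
  one_mem' := by
    refine ⟨0, 0, fun t ↦ by simp, fun t ↦ by simp, fun x ↦ ?_, fun x ↦ by simp⟩
    change π 1 x = shiftHead 0 x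
    rw [map_one, shiftHead_zero]
    rfl
  mul_mem' := by
    rintro ⟨⟨f, g⟩, v⟩ ⟨⟨f', g'⟩, v'⟩ ⟨p, q, hp, hq, hg, hf⟩ ⟨p', q', hp', hq', hg', hf'⟩
    simp only at hp hq hg hf hp' hq' hg' hf'
    have h2 : (2 : ZMod 2) = 0 := rfl
    -- The shift by `v` replaces `x 0` by `x 0 + v` in the second factor, which adds `2 q' v` to the
    -- constant term; being even, it is invisible modulo 2.
    refine ⟨fun t ↦ p t + p' t + 2 * q' t * ((v.toAdd (t, 2)).val : ℤ), fun t ↦ q t + q' t,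
      fun t ↦ ?_, fun t ↦ ?_, fun x ↦ ?_, fun x ↦ ?_⟩
    · push_cast
      rw [h2, zero_mul, zero_mul, add_zero, ← hp, ← hp']
      rfl
    · push_cast
      rw [← hq, ← hq']
      rfl
    · change π (g * g') x = _
      rw [map_mul, Equiv.Perm.mul_apply, hg', hg, shiftHead_shiftHead]
      rfl
    · change (f x).toAdd + (f' ((π g)⁻¹ x)).toAdd = _
      rw [hf, hf', inv_apply_eq_shiftHead hg]
      have h := two_mul_val_add hc (v.toAdd (Fin.tail x, 2)) (x 0).toAdd
      simp only [shiftHead, Fin.tail_cons, Fin.cons_zero, toAdd_mul, toAdd_ofAdd]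
      push_cast
      linear_combination (q' (Fin.tail x) : ZMod n) * h
  inv_mem' := by
    rintro ⟨⟨f, g⟩, v⟩ ⟨p, q, hp, hq, hg, hf⟩
    simp only at hp hq hg hf
    have h2 : (2 : ZMod 2) = 0 := rfl
    refine ⟨fun t ↦ -p t - 2 * q t * ((v.toAdd (t, 2)).val : ℤ), fun t ↦ -q t,
      fun t ↦ ?_, fun t ↦ ?_, fun x ↦ ?_, fun x ↦ ?_⟩
    · push_cast
      rw [h2, zero_mul, zero_mul, sub_zero, ← hp]
      rfl
    · push_cast
      rw [← hq]
      rfl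
    · change π g⁻¹ x = shiftHead (fun t ↦ -v.toAdd (t, 2)) x
      simp only [CharTwo.neg_eq]
      rw [map_inv, inv_apply_eq_shiftHead hg]
    · change -(f ((π g⁻¹)⁻¹ x)).toAdd = _
      rw [map_inv, inv_inv, hf, hg]
      have h := two_mul_val_add hc (v.toAdd (Fin.tail x, 2)) (x 0).toAdd
      simp only [shiftHead, Fin.tail_cons, Fin.cons_zero, toAdd_mul, toAdd_ofAdd]
      push_cast
      linear_combination -(q (Fin.tail x) : ZMod n) * h

end TwoLower

/-- The rank of `C_{2^a} ≀ W_{s+1}(2)` is at least `3 * 2 ^ s` when `a ≥ 2`. -/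
lemma three_mul_two_pow_le_subgroupRank {a : ℕ} (ha : 2 ≤ a) (s : ℕ) :
    ((3 * 2 ^ s : ℕ) : ℕ∞) ≤ subgroupRank (XGroup a (s + 1) 2) := by
  have hc : 4 * ((2 ^ (a - 2) : ℕ) : ZMod (2 ^ a)) = 0 := by
    obtain ⟨b, rfl⟩ := Nat.exists_eq_add_of_le ha
    have : 4 * 2 ^ b = 2 ^ (2 + b) := by ring
    rw [Nat.add_sub_cancel_left]
    exact_mod_cast (congrArg (Nat.cast : ℕ → ZMod (2 ^ (2 + b))) this).trans (ZMod.natCast_self _)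
  have hcard : 3 * 2 ^ s ≤
      Group.rank (Multiplicative ((Fin s → CyclicGrp 2) × Fin 3 → ZMod 2)) := by
    refine le_trans (le_of_eq ?_) (card_le_rank_multiplicative_pi _ 2)
    rw [Nat.card_prod, Nat.card_fun, Nat.card_fin, Nat.card_fin, card_cyclicGrp, mul_comm]
  refine (Nat.cast_le.2 hcard).trans (rank_le_subgroupRank
    (frattiniRelation (iteratedWreathToPermHom (CyclicGrp 2) (s + 1)) _ hc) ?_ ?_)
  · rintro v ⟨p, q, hp, hq, hg, hf⟩
    have hp0 : ∀ t, (p t : ZMod 2) = 0 := fun t ↦ by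
      have := hf (Fin.cons (α := fun _ ↦ CyclicGrp 2) 1 t)
      refine intCast_zmod_two_eq_zero_of_mul ha (p t) 1 ?_ (Or.inl rfl)
      simpa using this.symm
    have hq0 : ∀ t, (q t : ZMod 2) = 0 := fun t ↦ by
      -- The difference between the two points of a pair isolates `c * 2q`, and `c` has additive
      -- order 4.
      have h₀ := hf (Fin.cons (α := fun _ ↦ CyclicGrp 2) 1 t)
      have h₁ := hf (Fin.cons (α := fun _ ↦ CyclicGrp 2) (Multiplicative.ofAdd 1) t)
      refine intCast_zmod_two_eq_zero_of_mul ha (q t) 2 ?_ (Or.inr rfl)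
      simp only [SemidirectProduct.one_left, Pi.one_apply, toAdd_one, Fin.tail_cons, Fin.cons_zero,
        ZMod.val_zero, toAdd_ofAdd, show (1 : ZMod 2).val = 1 from rfl] at h₀ h₁
      push_cast at h₀ h₁ ⊢
      linear_combination h₀ - h₁
    have hg0 : ∀ t, v.toAdd (t, 2) = 0 := fun t ↦ by
      have h := congrFun (hg (Fin.cons (α := fun _ ↦ CyclicGrp 2) 1 t)) 0
      simp only [SemidirectProduct.one_right, map_one, Equiv.Perm.one_apply, shiftHead,
        Fin.tail_cons, Fin.cons_zero, mul_one] at h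
      exact h.symm
    refine Multiplicative.toAdd.injective (funext ?_)
    rintro ⟨t, i⟩
    fin_cases i
    · exact (hp t).trans (hp0 t)
    · exact (hq t).trans (hq0 t)
    · exact hg0 t
  · intro v
    obtain ⟨w, hw⟩ := exists_iteratedWreathToPermHom_eq_cons (G := CyclicGrp 2) s
      fun t ↦ Multiplicative.ofAdd (v.toAdd (t, 2))
    exact ⟨⟨fun x ↦ Multiplicative.ofAdd (_ * _), w⟩, fun t ↦ (v.toAdd (t, 0)).val,
      fun t ↦ (v.toAdd (t, 1)).val, fun t ↦ by simp, fun t ↦ by simp, hw, fun x ↦ rfl⟩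

/-! ### Transfer to the iterated wreath product -/

section Main

lemma card_points (r ℓ : ℕ) : Nat.card (Fin r → CyclicGrp ℓ) = ℓ ^ r := by
  rw [Nat.card_fun, Nat.card_fin, card_cyclicGrp]

variable {ℓ : ℕ} [hℓ : Fact ℓ.Prime]

lemma isPGroup_XGroup (a r : ℕ) : IsPGroup ℓ (XGroup a r ℓ) := by
  refine IsPGroup.of_card (n := a * ℓ ^ r + ∑ i ∈ Finset.range r, ℓ ^ i) ?_
  rw [Nat.card_congr SemidirectProduct.equivProd, Nat.card_prod, Nat.card_fun, card_points,
    IteratedWreathProduct.card, card_cyclicGrp, card_cyclicGrp, ← pow_mul, ← pow_add]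

/-- The action on points is faithful, so X embeds in the full monomial group. The hypothesis `hN`
says that `N` is at least the integer part of `p ℓ^r / q`. -/
lemma mul_subgroupRank_le {a r p q N : ℕ}
    (h : MonomialBound ℓ (CyclicGrp (ℓ ^ a)) p q (Fin r → CyclicGrp ℓ))
    (hN : p * ℓ ^ r < q * (N + 1)) : subgroupRank (XGroup a r ℓ) ≤ N := by
  let φ : XGroup a r ℓ →* PermWreathProduct (CyclicGrp (ℓ ^ a))
      (MonoidHom.id (Equiv.Perm (Fin r → CyclicGrp ℓ))) :=
    SemidirectProduct.map (MonoidHom.id _) (iteratedWreathToPermHom (CyclicGrp ℓ) r) fun _ ↦ rfl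
  have hφ : Function.Injective φ := fun x y hxy ↦
    SemidirectProduct.ext
    (congrArg SemidirectProduct.left hxy : (φ x).left = (φ y).left)
    (iteratedWreathToPermHomInj _ r
      (congrArg SemidirectProduct.right hxy : (φ x).right = (φ y).right))
  refine iSup_le fun H ↦ Nat.cast_le.2 ?_
  have := h H ((isPGroup_XGroup a r).to_subgroup H) (φ.comp H.subtype)
    (hφ.comp H.subtype_injective)
  rw [card_points] at this
  exact Nat.lt_succ_iff.1 (Nat.lt_of_mul_lt_mul_left (this.trans_lt hN))

lemma cyclicGrp_pow (n : ℕ) (x : CyclicGrp n) : x ^ n = 1 := by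
  have : n • x.toAdd = 0 := by simp
  exact congrArg Multiplicative.ofAdd this

end Main

end WreathRank

theorem mainTheorem7 (ℓ : ℕ) [Fact ℓ.Prime] (a r : ℕ) (ha : 1 ≤ a) :
    subgroupRank (XGroup a r ℓ) =
      if ℓ = 2 ∧ 2 ≤ a ∧ 1 ≤ r then ((3 * 2 ^ (r - 1) : ℕ) : ℕ∞) else ((ℓ ^ r : ℕ) : ℕ∞) := by
  split_ifs with h
  · obtain ⟨rfl, ha2, hr⟩ := h
    obtain ⟨s, rfl⟩ := Nat.exists_eq_add_of_le' hr
    refine le_antisymm ?_ (WreathRank.three_mul_two_pow_le_subgroupRank ha2 s)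
    refine WreathRank.mul_subgroupRank_le
      (WreathRank.monomialBound_two (WreathRank.cyclicGrp_pow _) _) ?_
    rw [Nat.add_sub_cancel, pow_succ]
    omega
  · refine le_antisymm ?_ ?_
    · by_cases h' : ℓ ≠ 2 ∨ a = 1
      · refine WreathRank.mul_subgroupRank_le
          (WreathRank.monomialBound_one (WreathRank.cyclicGrp_pow _) (h'.imp_right ?_) _) (by omega)
        rintro rfl x
        simpa using WreathRank.cyclicGrp_pow _ x
      · push Not at h'
        obtain ⟨rfl, ha1⟩ := h'
        obtain rfl : r = 0 := by
          by_contra hr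
          exact h ⟨rfl, by omega, by omega⟩
        -- With one point, `2 d ≤ 3` already forces `d ≤ 1`.
        exact WreathRank.mul_subgroupRank_le
          (WreathRank.monomialBound_two (WreathRank.cyclicGrp_pow _) _) (by norm_num)
    · rw [← WreathRank.card_points r ℓ]
      exact WreathRank.card_le_subgroupRank _ ℓ a (by omega)
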